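/- Let $M\ge 0$ and let nonnegative integer gains $n_{A_iR},n_{B_iR}$ (uplink) and $n_{RA_i},n_{RB_i}$ (downlink), $i=1,\dots,M$, be given; let $q$ be the maximum of these gains and let $\mathbf S$ be the $q\times q$ down-shift matrix over $\mathbb F_2$. In the full-duplex $M$-pair bidirectional linear shift deterministic relay network, at each time $t$ the nodes $A_1,B_1,\dots,A_M,B_M$ and the relay $R$ transmit vectors $\mathbf x_{A_i}[t],\mathbf x_{B_i}[t],\mathbf x_R[t]\in\mathbb F_2^q$ and receive $$\mathbf y_R[t]=\sum_{i=1}^M\big(\mathbf S^{q-n_{A_iR}}\mathbf x_{A_i}[t]+\mathbf S^{q-n_{B_iR}}\mathbf x_{B_i}[t]\big),\qquad \mathbf y_{A_i}[t]=\mathbf S^{q-n_{RA_i}}\mathbf x_R[t],\qquad \mathbf y_{B_i}[t]=\mathbf S^{q-n_{RB_i}}\mathbf x_R[t].$$ Each $A_i$ has a message for $B_i$ at rate $R_{A_i}$ and each $B_i$ a message for $A_i$ at rate $R_{B_i}$, in bits per time step; all messages are independent and uniform. What a user transmits depends on its message and its past received signals, and what the relay transmits depends on its past received signals. The capacity region is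 the closure of the set of nonnegative rate tuples that are achievable by block codes with error probability tending to $0$ as the block length tends to infinity. Let the cut-set region be the set of nonnegative $2M$-tuples $(R_{A_1},R_{B_1},\dots,R_{A_M},R_{B_M})$ of real numbers such that $$\sum_{i\in\mathcal U}\big[\ell_iR_{A_i}+(1-\ell_i)R_{B_i}\big]\le\min\Big(\max_{i\in\mathcal U}\big(\ell_in_{A_iR}+(1-\ell_i)n_{B_iR}\big),\ \max_{i\in\mathcal U}\big(\ell_in_{RB_i}+(1-\ell_i)n_{RA_i}\big)\Big)$$ for all nonempty $\mathcal U\subseteq\{1,\dots,M\}$ and all $\ell_1,\dots,\ell_M\in\{0,1\}$. A divide-and-conquer strategy over blocks of $Q\ge1$ time steps is the following. In each block every user transmits on each of its $Qq$ signal levels (pairs of a time step and a level) either one of its message bits or $0$, in such a way that each of the $Qq$ signal levels received by the relay is assigned to at most one pair, and only users of that pair contribute to the signal received on it. The relay applies a fixed permutation to the $Qq$ received bits of the block and transmits the result in the next block. From the block that it then receives and its own message bits, each user decodes the message bits of its partner. Theorem. For all $M$ and all gains, the capacity region equals the cut-set region, and it is achieved by divide-and-conquer strategies: the closure of the set of rate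 tuples that are achievable by codes that repeat a divide-and-conquer strategy, block after block, equals the cut-set region as well. More precisely, if a tuple $\mathbf R$ of the cut-set region and an integer $Q\ge1$ are such that all entries of $Q\mathbf R$ are integers, then there is a divide-and-conquer strategy over blocks of $Q$ time steps by which, in each block and without error, each $A_i$ conveys $QR_{A_i}$ bits to $B_i$ and each $B_i$ conveys $QR_{B_i}$ bits to $A_i$; for integral $\mathbf R$ one may take $Q=1$. -/

import Mathlib

open Matrix

namespace BidirectionalRelay

/-! ### The linear shift deterministic model -/

/-- The binary signal vectors with `q` levels; level `0` is the most significant one. -/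
abbrev Vec (q : ℕ) : Type := Fin q → ZMod 2

/-- The `q × q` shift matrix over `𝔽₂`: it moves every level down by one and fills in a zero. -/
def shiftMatrix (q : ℕ) : Matrix (Fin q) (Fin q) (ZMod 2) :=
  Matrix.of fun i j => if (i : ℕ) = (j : ℕ) + 1 then 1 else 0

/-- The number of signal levels `q = max n_(i,j)` of a network with the given channel gains. -/
def levels {V : Type*} [Fintype V] (gain : V → V → ℕ) : ℕ :=
  Finset.univ.sup fun e : V × V => gain e.1 e.2

/-- The linear shift deterministic channel: if node `k` transmits `x k`, then node `j` receives
`∑ k, S ^ (q - n_(k,j)) x k`. -/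
def channel {V : Type*} [Fintype V] (gain : V → V → ℕ) (x : V → Vec (levels gain)) (j : V) :
    Vec (levels gain) :=
  ∑ k, (shiftMatrix (levels gain) ^ (levels gain - gain k j)) *ᵥ x k

/-! ### The `M`-pair bidirectional relay network -/

/-- The users: `(i, true)` is the node `A_i` and `(i, false)` is the node `B_i`. -/
abbrev User (M : ℕ) : Type := Fin M × Bool

/-- The node with which a user exchanges messages. -/
def partner {M : ℕ} (u : User M) : User M := (u.1, !u.2)

/-- All nodes: the users `some u` and the relay `none`. -/
abbrev Node (M : ℕ) : Type := Option (User M)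

/-- The channel gains of an `M`-pair bidirectional relay network: `up u` is the gain from the user
`u` to the relay, `down u` is the gain from the relay to the user `u`. -/
structure Network (M : ℕ) where
  up : User M → ℕ
  down : User M → ℕ

namespace Network

variable {M : ℕ}

/-- The gains as a linear shift deterministic network; there are no links between users. -/
def gain (N : Network M) : Node M → Node M → ℕ
  | some u, none => N.up u
  | none, some u => N.down u
  | _, _ => 0

/-- The number of signal levels of the network. -/
def q (N : Network M) : ℕ := levels N.gain

/-- What node `j` receives in one time step if the nodes transmit `x`. -/
def receive (N : Network M) (x : Node M → Vec N.q) (j : Node M) : Vec N.q :=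
  channel N.gain x j

/-- The cut-set region: the nonnegative rate tuples (`R (i, true)` is the rate `R_{A_i}` from `A_i`
to `B_i`, `R (i, false)` is the rate `R_{B_i}` from `B_i` to `A_i`) such that for every set `U` of
pairs and every choice `ℓ` of one node of each pair, the sum of the rates of the chosen nodes is at
most the largest uplink gain of the chosen nodes and at most the largest downlink gain of their
partners. (For `U = ∅` this reads `0 ≤ 0`.) -/
def cutSetRegion (N : Network M) : Set (User M → ℝ) :=
  {R | (∀ u, 0 ≤ R u) ∧ ∀ (U : Finset (Fin M)) (ℓ : Fin M → Bool),
    ∑ i ∈ U, R (i, ℓ i) ≤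
      ((min (U.sup fun i => N.up (i, ℓ i)) (U.sup fun i => N.down (partner (i, ℓ i))) : ℕ) : ℝ)}

end Network

/-! ### Codes and the capacity region -/

/-- A block code of length `n` with a full-duplex relay. Each user `u` has a message for its partner
in the finite nonempty set `Msg u`. At time `t`, a user transmits a function of its message and of
what it received at times `0, …, t - 1`; the relay transmits a function of what it received at times
`0, …, t - 1`. After time `n - 1`, a user estimates its partner's message from its own message and
everything that it received. -/
structure Code {M : ℕ} (N : Network M) (n : ℕ) where
  Msg : User M → Type
  finite_msg : ∀ u, Finite (Msg u)
  nonempty_msg : ∀ u, Nonempty (Msg u)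
  enc : ∀ u, Msg u → (t : ℕ) → (Fin t → Vec N.q) → Vec N.q
  relay : (t : ℕ) → (Fin t → Vec N.q) → Vec N.q
  dec : ∀ u, Msg u → (Fin n → Vec N.q) → Msg (partner u)

namespace Code

variable {M n : ℕ} {N : Network M}

/-- What a node transmits at time `t`, given the messages `w` and its past received signals. -/
def send (c : Code N n) (w : ∀ u, c.Msg u) : Node M → (t : ℕ) → (Fin t → Vec N.q) → Vec N.q
  | none, t, h => c.relay t h
  | some u, t, h => c.enc u (w u) t h

/-- The signal received by node `j` at time `t` if the messages are `w`. -/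
def recv (c : Code N n) (w : ∀ u, c.Msg u) (t : ℕ) (j : Node M) : Vec N.q :=
  N.receive (fun k => c.send w k t fun s : Fin t => recv c w s k) j
termination_by t
decreasing_by exact s.isLt

/-- The average probability that some user decodes its partner's message wrongly, for independent
and uniformly distributed messages. -/
noncomputable def errorProb (c : Code N n) : ℝ :=
  (Nat.card {w : ∀ u, c.Msg u //
      ∃ u, c.dec u (w u) (fun t : Fin n => c.recv w t (some u)) ≠ w (partner u)} : ℝ) /
    (Nat.card (∀ u, c.Msg u) : ℝ)

end Code

/-- The rate tuple `R` (bits per channel use) is achievable with codes from the class `𝒞`: for all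
large `n` there are codes of length `n` in `𝒞` with at least `2 ^ (n R_u)` messages for each user
`u`, and with error probabilities that tend to zero. -/
def Achievable {M : ℕ} (N : Network M) (𝒞 : ∀ n, Set (Code N n)) (R : User M → ℝ) : Prop :=
  (∀ u, 0 ≤ R u) ∧ ∀ ε : ℝ, 0 < ε → ∃ n₀ : ℕ, ∀ n ≥ n₀, ∃ c ∈ 𝒞 n,
    (∀ u, (2 : ℝ) ^ ((n : ℝ) * R u) ≤ (Nat.card (c.Msg u) : ℝ)) ∧ c.errorProb ≤ ε

/-- The region achieved by the codes from the class `𝒞`: the closure of the achievable rates. -/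
def achievableRegion {M : ℕ} (N : Network M) (𝒞 : ∀ n, Set (Code N n)) : Set (User M → ℝ) :=
  closure {R | Achievable N 𝒞 R}

/-- The capacity region: no restriction on the codes. -/
def capacityRegion {M : ℕ} (N : Network M) : Set (User M → ℝ) :=
  achievableRegion N fun _ => Set.univ

/-! ### Divide-and-conquer relaying -/

/-- A divide-and-conquer strategy over blocks of `Q` time steps. A signal level of a block is a pair
`(k, l)` of a time step `k` in the block and a level `l`. In each block user `u` sends `bits u`
message bits.
* `place u (k, l)` is the message bit that `u` transmits, uncoded, on the level `(k, l)`; with `none`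
  it transmits `0` there.
* `owner` divides the levels of the signal received by the relay between the pairs.
* `orthogonal`: on a level that is not assigned to its pair, a user does not contribute to the signal
  received by the relay.
* `perm` is the permutation of the levels that the relay applies to the received block.
* `dec u` recovers the bits of the partner of `u` from those of `u` and from the block received
  by `u`. -/
structure DCScheme {M : ℕ} (N : Network M) (Q : ℕ) where
  pos : 0 < Q
  bits : User M → ℕ
  place : ∀ u, Fin Q × Fin N.q → Option (Fin (bits u))
  owner : Fin Q × Fin N.q → Option (Fin M)
  orthogonal : ∀ (u : User M) (w : Vec (bits u)) (k : Fin Q) (l : Fin N.q),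
    ((shiftMatrix N.q ^ (N.q - N.up u)) *ᵥ fun m => (place u (k, m)).elim 0 w) l ≠ 0 →
      owner (k, l) = some u.1
  perm : Equiv.Perm (Fin Q × Fin N.q)
  dec : ∀ u, Vec (bits u) → (Fin Q → Vec N.q) → Vec (bits (partner u))

namespace DCScheme

variable {M Q : ℕ} {N : Network M}

/-- The block transmitted by the user `u` for the message bits `w`. -/
def userBlock (s : DCScheme N Q) (u : User M) (w : Vec (s.bits u)) : Fin Q → Vec N.q :=
  fun k l => (s.place u (k, l)).elim 0 w

/-- The block received by the relay if the users transmit the message bits `w`. -/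
def relayReceived (s : DCScheme N Q) (w : ∀ u, Vec (s.bits u)) : Fin Q → Vec N.q :=
  fun k => N.receive (fun j => j.elim 0 fun u => s.userBlock u (w u) k) none

/-- The permuted block that the relay transmits after having received the block `y`. -/
def relayBlock (s : DCScheme N Q) (y : Fin Q → Vec N.q) : Fin Q → Vec N.q :=
  fun k l => y (s.perm (k, l)).1 (s.perm (k, l)).2

/-- The block received by the user `u` if the relay transmits the block `x`. -/
def userReceived (_s : DCScheme N Q) (x : Fin Q → Vec N.q) (u : User M) : Fin Q → Vec N.q :=
  fun k => N.receive (fun j => j.elim (x k) fun _ => 0) (some u)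

/-- Every user recovers all bits of its partner, whatever the message bits are. -/
def Correct (s : DCScheme N Q) : Prop :=
  ∀ (w : ∀ u, Vec (s.bits u)) (u : User M),
    s.dec u (w u) (s.userReceived (s.relayBlock (s.relayReceived w)) u) = w (partner u)

/-- The signal received at time `i`, or zero if it is not among the given received signals. -/
def lookup {q t : ℕ} (h : Fin t → Vec q) (i : ℕ) : Vec q :=
  if hi : i < t then h ⟨i, hi⟩ else 0

/-- The code of length `n` that repeats the strategy `s`, block after block. There are `n / Q` full
blocks, numbered from `0`. In each of them but the last the users transmit new message bits. The
relay is silent in block `0`, and transmits in block `b + 1` the permutation of what it received in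
block `b`; after block `b + 1` the users decode the bits of block `b`. -/
def toCode (s : DCScheme N Q) (n : ℕ) : Code N n where
  Msg u := Fin (n / Q - 1) → Vec (s.bits u)
  finite_msg _ := inferInstance
  nonempty_msg _ := inferInstance
  enc u w t _ :=
    if hb : t / Q < n / Q - 1 then s.userBlock u (w ⟨t / Q, hb⟩) ⟨t % Q, Nat.mod_lt t s.pos⟩ else 0
  relay t h :=
    if Q ≤ t then
      s.relayBlock (fun k => lookup h ((t / Q - 1) * Q + k)) ⟨t % Q, Nat.mod_lt t s.pos⟩
    else 0
  dec u w y := fun b => s.dec u (w b) fun k => lookup y ((b + 1) * Q + k)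

end DCScheme

/-- The codes that repeat a divide-and-conquer strategy. -/
def divideAndConquerCodes {M : ℕ} (N : Network M) (n : ℕ) : Set (Code N n) :=
  {c | ∃ (Q : ℕ) (s : DCScheme N Q), c = s.toCode n}

end BidirectionalRelay

namespace BidirectionalRelay

/-! ### The channel, level by level -/

/-! Converse: choose at most one user of each pair. Given all other messages, the decisions on the
chosen users' messages depend only on the bits that cross a cut: the chosen users' uplink
contribution, or the part of the relay signal that their partners can see. Counting correctly
decoded message tuples (`one_sub_errorProb_mul_prod_le`) bounds the sum rate.

Achievability: bit `j` of `A_i` and bit `j` of `B_i` share one relay level (a slot). The relay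
forwards their sum, and each user subtracts its own bit. A slot must lie within reach of every user
that uses it. The admissible sets of levels are nested, so Hall's condition reduces to the cut-set
inequalities (`card_filter_slot_le`, `exists_allocation`). Uplink and downlink are allocated
separately, and the relay's permutation joins the two allocations. Blocks of length `Q` absorb
denominators, and closure gives the real tuples. -/

theorem shiftMatrix_mulVec_apply {q : ℕ} (x : Vec q) (l : Fin q) :
    (shiftMatrix q *ᵥ x) l =
      if h : 1 ≤ (l : ℕ) then x ⟨l - 1, by omega⟩ else 0 := by
  simp only [mulVec, dotProduct, shiftMatrix, Matrix.of_apply, ite_mul, one_mul, zero_mul]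
  split_ifs with h
  · rw [Finset.sum_eq_single ⟨(l : ℕ) - 1, by omega⟩]
    · rw [if_pos (by simp; omega)]
    · intro b _ hb
      rw [if_neg]
      intro hl
      exact hb (Fin.ext (by simp; omega))
    · simp
  · refine Finset.sum_eq_zero fun j _ => if_neg (by omega)

theorem shiftMatrix_pow_mulVec_apply {q : ℕ} (d : ℕ) (x : Vec q) (l : Fin q) :
    ((shiftMatrix q ^ d) *ᵥ x) l =
      if h : d ≤ (l : ℕ) then x ⟨l - d, by omega⟩ else 0 := by
  induction d generalizing l with
  | zero => simp
  | succ d ih =>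
    rw [pow_succ', ← mulVec_mulVec, shiftMatrix_mulVec_apply]
    split_ifs with h₁ h₂ h₂
    · rw [ih, dif_pos (by simp; omega)]
      congr 2
      simp only
      omega
    · rw [ih, dif_neg (by simp; omega)]
    · omega
    · rfl

namespace Network

variable {M : ℕ} (N : Network M)

theorem up_le_q (u : User M) : N.up u ≤ N.q :=
  Finset.le_sup (f := fun e : Node M × Node M => N.gain e.1 e.2)
    (Finset.mem_univ (some u, none))

theorem down_le_q (u : User M) : N.down u ≤ N.q :=
  Finset.le_sup (f := fun e : Node M × Node M => N.gain e.1 e.2)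
    (Finset.mem_univ (none, some u))

theorem shiftMatrix_pow_q_mulVec (x : Vec N.q) : (shiftMatrix N.q ^ N.q) *ᵥ x = 0 := by
  ext l
  rw [shiftMatrix_pow_mulVec_apply, dif_neg (by omega)]
  rfl

theorem receive_none (x : Node M → Vec N.q) :
    N.receive x none = ∑ u, (shiftMatrix N.q ^ (N.q - N.up u)) *ᵥ x (some u) := by
  have h := Fintype.sum_option fun k : Node M =>
    (shiftMatrix N.q ^ (N.q - N.gain k none)) *ᵥ x k
  refine h.trans ?_
  have h0 : N.q - N.gain none none = N.q := by simp [gain]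
  rw [h0, shiftMatrix_pow_q_mulVec, zero_add]
  rfl

theorem receive_some (x : Node M → Vec N.q) (u : User M) :
    N.receive x (some u) = (shiftMatrix N.q ^ (N.q - N.down u)) *ᵥ x none := by
  have h := Fintype.sum_option fun k : Node M =>
    (shiftMatrix N.q ^ (N.q - N.gain k (some u))) *ᵥ x k
  refine h.trans ?_
  have h0 : ∀ v : User M, N.q - N.gain (some v) (some u) = N.q := fun v => by simp [gain]
  simp only [h0, shiftMatrix_pow_q_mulVec, Finset.sum_const_zero, add_zero]
  rfl

end Network

@[simp] theorem partner_partner {M : ℕ} (u : User M) : partner (partner u) = u := by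
  simp [partner]

/-! ### The cut-set bound -/

namespace Code

variable {M n : ℕ} {N : Network M}

theorem recv_none (c : Code N n) (w : ∀ u, c.Msg u) (t : ℕ) :
    c.recv w t none = ∑ u, (shiftMatrix N.q ^ (N.q - N.up u)) *ᵥ
      c.enc u (w u) t fun s : Fin t => c.recv w s (some u) := by
  rw [recv, Network.receive_none]
  rfl

theorem recv_some (c : Code N n) (w : ∀ u, c.Msg u) (t : ℕ) (u : User M) :
    c.recv w t (some u) = (shiftMatrix N.q ^ (N.q - N.down u)) *ᵥ
      c.relay t fun s : Fin t => c.recv w s none := by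
  rw [recv, Network.receive_some]
  rfl

/-- If the decisions on the messages of the users in `C` depend only on the other messages and on
`D` bits per time step, then these messages have essentially at most `D` bits per time step. -/
theorem one_sub_errorProb_mul_prod_le (c : Code N n) (C : Finset (User M)) (D : ℕ)
    (Φ : (∀ u, c.Msg u) → Fin n → Fin D → ZMod 2)
    (hC : ∀ u, partner u ∈ C → u ∉ C)
    (hΦ : ∀ w w' : ∀ u, c.Msg u, (∀ u ∉ C, w u = w' u) → Φ w = Φ w' →
      ∀ u, partner u ∈ C → ∀ t < n, c.recv w t (some u) = c.recv w' t (some u)) :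
    (1 - c.errorProb) * ∏ u ∈ C, (Nat.card (c.Msg u) : ℝ) ≤ 2 ^ (n * D) := by
  classical
  have := c.finite_msg
  have := c.nonempty_msg
  set bad : (∀ u, c.Msg u) → Prop := fun w =>
    ∃ u, c.dec u (w u) (fun t : Fin n => c.recv w t (some u)) ≠ w (partner u) with hbad
  -- Correctly decoded tuples are determined by the messages outside `C` and the `n * D` bits of
  -- `Φ`.
  have hinj : Function.Injective
      (fun w : {w // ¬ bad w} =>
        ((fun u : {u // u ∉ C} => w.1 u), Φ w.1)) := by
    rintro ⟨w, hw⟩ ⟨w', hw'⟩ h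
    simp only [Prod.mk.injEq] at h
    obtain ⟨h₁, h₂⟩ := h
    have hoff : ∀ u ∉ C, w u = w' u := fun u hu => congrFun h₁ ⟨u, hu⟩
    simp only [hbad, not_exists, not_not] at hw hw'
    refine Subtype.ext (funext fun u => ?_)
    by_cases hu : u ∈ C
    · obtain ⟨v, rfl⟩ : ∃ v, u = partner v := ⟨partner u, by simp⟩
      change w (partner v) = w' (partner v)
      -- The receiver `v` is outside `C`, so its own message agrees too, and equal receptions give
      -- equal decisions.
      rw [← hw v, ← hw' v, hoff v (hC v hu)]
      congr 1
      exact funext fun t => hΦ w w' hoff h₂ v hu t t.isLt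
    · exact hoff u hu
  have hcard := Nat.card_le_card_of_injective _ hinj
  rw [Nat.card_prod, Nat.card_pi, Nat.card_pi] at hcard
  have hD : ∏ _i : Fin n, Nat.card (Fin D → ZMod 2) = 2 ^ (n * D) := by
    simp [← pow_mul, mul_comm]
  rw [hD] at hcard
  have htot : Nat.card {w // bad w} + Nat.card {w // ¬ bad w} = Nat.card (∀ u, c.Msg u) := by
    rw [← Nat.card_sum]
    exact Nat.card_congr (Equiv.sumCompl bad)
  have hpi : Nat.card (∀ u, c.Msg u) =
      (∏ u ∈ C, Nat.card (c.Msg u)) * ∏ u : {u // u ∉ C}, Nat.card (c.Msg u) := by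
    rw [Nat.card_pi, ← Finset.prod_coe_sort C]
    convert (Fintype.prod_subtype_mul_prod_subtype (fun u => u ∈ C)
      fun u => Nat.card (c.Msg u)).symm
  have hoffpos : 0 < ∏ u : {u // u ∉ C}, Nat.card (c.Msg u) :=
    Finset.prod_pos fun u _ => Nat.card_pos
  have hallpos : 0 < Nat.card (∀ u, c.Msg u) := Nat.card_pos
  have herr : (1 - c.errorProb) * (Nat.card (∀ u, c.Msg u) : ℝ) = Nat.card {w // ¬ bad w} := by
    have hp : (Nat.card (∀ u, c.Msg u) : ℝ) ≠ 0 := by exact_mod_cast hallpos.ne'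
    rw [errorProb, sub_mul, div_mul_cancel₀ _ hp, one_mul, ← htot]
    push_cast
    ring
  have hoffpos' : (0 : ℝ) < (∏ u : {u // u ∉ C}, Nat.card (c.Msg u) : ℕ) := by
    exact_mod_cast hoffpos
  refine le_of_mul_le_mul_right ?_ hoffpos'
  have hcard' : (Nat.card {w // ¬ bad w} : ℝ) ≤
      (∏ u : {u // u ∉ C}, Nat.card (c.Msg u) : ℕ) * 2 ^ (n * D) := by
    exact_mod_cast hcard
  calc _ = (1 - c.errorProb) * (Nat.card (∀ u, c.Msg u) : ℝ) := by
        rw [hpi]; push_cast; ring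
    _ ≤ _ := by rw [herr, mul_comm (2 ^ (n * D) : ℝ)]; exact hcard'

/-- The sum of the contributions of `C` at the relay vanishes outside the lowest `D` levels. With
the other messages it suffices to simulate the whole network. -/
theorem uplink_cut (c : Code N n) (C : Finset (User M)) (hC : ∀ u, partner u ∈ C → u ∉ C) :
    (1 - c.errorProb) * ∏ u ∈ C, (Nat.card (c.Msg u) : ℝ) ≤ 2 ^ (n * C.sup N.up) := by
  set D := C.sup N.up
  have hDq : D ≤ N.q := Finset.sup_le fun u _ => N.up_le_q u
  let sig : (∀ u, c.Msg u) → ℕ → Vec N.q := fun w t =>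
    ∑ u ∈ C, (shiftMatrix N.q ^ (N.q - N.up u)) *ᵥ
      c.enc u (w u) t fun s : Fin t => c.recv w s (some u)
  have hsig : ∀ w t (l : Fin N.q), (l : ℕ) < N.q - D → sig w t l = 0 := by
    intro w t l hl
    simp only [sig, Finset.sum_apply]
    refine Finset.sum_eq_zero fun u hu => ?_
    have : N.up u ≤ D := Finset.le_sup (f := N.up) hu
    rw [shiftMatrix_pow_mulVec_apply, dif_neg (by omega)]
  refine c.one_sub_errorProb_mul_prod_le C D
    (fun w t d => sig w t ⟨N.q - D + d, by omega⟩) hC ?_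
  intro w w' hoff h
  have hs : ∀ t < n, sig w t = sig w' t := by
    intro t ht
    ext l
    by_cases hl : (l : ℕ) < N.q - D
    · rw [hsig w t l hl, hsig w' t l hl]
    · have := congrFun (congrFun h ⟨t, ht⟩) ⟨l - (N.q - D), by omega⟩
      have hl' : N.q - D + (l - (N.q - D)) = (l : ℕ) := by omega
      simpa only [hl'] using this
  -- Causality permits induction on time: equal pasts and equal contributions of `C` give equal
  -- receptions everywhere.
  have hall : ∀ t < n, ∀ j, c.recv w t j = c.recv w' t j := by
    intro t
    induction t using Nat.strong_induction_on with
    | _ t ih =>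
      intro ht j
      have hist : ∀ k, (fun s : Fin t => c.recv w s k) = fun s : Fin t => c.recv w' s k :=
        fun k => funext fun s => ih s s.isLt (s.isLt.trans ht) k
      cases j with
      | none =>
        classical
        rw [recv_none, recv_none, ← Finset.sum_add_sum_compl C, ← Finset.sum_add_sum_compl C]
        congr 1
        · exact hs t ht
        · refine Finset.sum_congr rfl fun u hu => ?_
          rw [hoff u (Finset.mem_compl.mp hu), hist]
      | some u => rw [recv_some, recv_some, hist]
  exact fun u _ t ht => hall t ht _

/-- The partners of `C` see only the top `D` levels of what the relay sends. -/
theorem downlink_cut (c : Code N n) (C : Finset (User M)) (hC : ∀ u, partner u ∈ C → u ∉ C) :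
    (1 - c.errorProb) * ∏ u ∈ C, (Nat.card (c.Msg u) : ℝ) ≤
      2 ^ (n * C.sup fun u => N.down (partner u)) := by
  set D := C.sup fun u => N.down (partner u) with hD
  have hDq : D ≤ N.q := Finset.sup_le fun u _ => N.down_le_q _
  refine c.one_sub_errorProb_mul_prod_le C D
    (fun w t d => c.relay t (fun s : Fin t => c.recv w s none) ⟨d, by omega⟩) hC ?_
  intro w w' _ h u hu t ht
  have huD : N.down u ≤ D := by
    have := Finset.le_sup (f := fun u => N.down (partner u)) hu
    rwa [partner_partner] at this
  rw [recv_some, recv_some]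
  ext l
  rw [shiftMatrix_pow_mulVec_apply, shiftMatrix_pow_mulVec_apply]
  split_ifs with hl
  · exact congrFun (congrFun h ⟨t, ht⟩) ⟨l - (N.q - N.down u), by omega⟩
  · rfl

end Code

variable {M : ℕ} {N : Network M}

/-- Error probability `1 / 2` already suffices: it costs one bit in total, which is negligible
against `n`. -/
theorem Achievable.sum_le {𝒞 : ∀ n, Set (Code N n)} {R : User M → ℝ} (hR : Achievable N 𝒞 R)
    (C : Finset (User M)) (D : ℕ)
    (hD : ∀ (n : ℕ) (c : Code N n),
      (1 - c.errorProb) * ∏ u ∈ C, (Nat.card (c.Msg u) : ℝ) ≤ 2 ^ (n * D)) :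
    ∑ u ∈ C, R u ≤ D := by
  obtain ⟨n₀, hn₀⟩ := hR.2 (1 / 2) (by norm_num)
  have key : ∀ n ≥ n₀, (n : ℝ) * ∑ u ∈ C, R u ≤ n * D + 1 := by
    intro n hn
    obtain ⟨c, _, hc, he⟩ := hn₀ n hn
    have h₁ : (2 : ℝ) ^ ((n : ℝ) * ∑ u ∈ C, R u) ≤ ∏ u ∈ C, (Nat.card (c.Msg u) : ℝ) := by
      rw [Finset.mul_sum, Real.rpow_sum_of_pos (by norm_num)]
      exact Finset.prod_le_prod (fun u _ => by positivity) fun u _ => hc u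
    have h₂ : (1 / 2 : ℝ) * ∏ u ∈ C, (Nat.card (c.Msg u) : ℝ) ≤ 2 ^ (n * D) :=
      le_trans (mul_le_mul_of_nonneg_right (by linarith) (by positivity)) (hD n c)
    have h₃ : (2 : ℝ) ^ ((n : ℝ) * ∑ u ∈ C, R u) ≤ (2 : ℝ) ^ ((n : ℝ) * D + 1) := by
      rw [Real.rpow_add (by norm_num), Real.rpow_one, ← Nat.cast_mul, Real.rpow_natCast]
      linarith
    exact (Real.rpow_le_rpow_left_iff (by norm_num)).mp h₃
  by_contra! hlt
  obtain ⟨k, hk⟩ := exists_nat_gt (1 / (∑ u ∈ C, R u - D))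
  rw [div_lt_iff₀ (by linarith)] at hk
  have h := key (max n₀ k) (le_max_left _ _)
  have hk' : (k : ℝ) ≤ (max n₀ k : ℕ) := by exact_mod_cast le_max_right _ _
  nlinarith [mul_le_mul_of_nonneg_right hk' (by linarith : (0 : ℝ) ≤ ∑ u ∈ C, R u - D)]

theorem Achievable.mem_cutSetRegion {𝒞 : ∀ n, Set (Code N n)} {R : User M → ℝ}
    (hR : Achievable N 𝒞 R) : R ∈ N.cutSetRegion := by
  refine ⟨hR.1, fun U ℓ => ?_⟩
  classical
  have hinj : Set.InjOn (fun i : Fin M => ((i, ℓ i) : User M)) U :=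
    fun i _ j _ h => congrArg Prod.fst h
  set C : Finset (User M) := U.image fun i => (i, ℓ i) with hCdef
  have hC : ∀ u, partner u ∈ C → u ∉ C := by
    rintro ⟨i, b⟩ h h'
    simp only [hCdef, partner, Finset.mem_image, Prod.mk.injEq] at h h'
    obtain ⟨j, _, rfl, hj⟩ := h
    obtain ⟨k, _, rfl, hk⟩ := h'
    rw [hk] at hj
    simp at hj
  have hsum : ∑ i ∈ U, R (i, ℓ i) = ∑ u ∈ C, R u := (Finset.sum_image hinj).symm
  have h₁ : ∑ u ∈ C, R u ≤ (C.sup N.up : ℕ) := hR.sum_le C _ fun _ c => c.uplink_cut C hC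
  have h₂ : ∑ u ∈ C, R u ≤ (C.sup fun u => N.down (partner u) : ℕ) :=
    hR.sum_le C _ fun _ c => c.downlink_cut C hC
  rw [Finset.sup_image] at h₁ h₂
  rw [hsum, Nat.cast_min]
  exact le_min h₁ h₂

theorem isClosed_cutSetRegion (N : Network M) : IsClosed N.cutSetRegion := by
  simp only [Network.cutSetRegion, Set.ofPred_and, Set.ofPred_forall]
  refine (isClosed_iInter fun u => isClosed_le continuous_const (continuous_apply u)).inter
    (isClosed_iInter fun U => isClosed_iInter fun ℓ => isClosed_le ?_ continuous_const)
  fun_prop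

theorem achievableRegion_subset_cutSetRegion (𝒞 : ∀ n, Set (Code N n)) :
    achievableRegion N 𝒞 ⊆ N.cutSetRegion :=
  closure_minimal (fun _ hR => hR.mem_cutSetRegion) (isClosed_cutSetRegion N)

theorem achievableRegion_subset_capacityRegion (𝒞 : ∀ n, Set (Code N n)) :
    achievableRegion N 𝒞 ⊆ capacityRegion N :=
  closure_mono fun _ hR => ⟨hR.1, fun ε hε => (hR.2 ε hε).imp fun _ h n hn =>
    let ⟨c, _, hc⟩ := h n hn
    ⟨c, trivial, hc⟩⟩

/-! ### Allocation of signal levels -/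

section Allocation

variable {M : ℕ}

/-- The relay levels needed by the pairs: the pair `i` needs one for each bit of its user with the
larger rate; the bits of the other user are superimposed. -/
abbrev Slot (r : User M → ℕ) : Type := Σ i : Fin M, Fin (max (r (i, true)) (r (i, false)))

/-- The relay level on which the user `u` sends its bit `j`. -/
def slot (r : User M → ℕ) (u : User M) (j : Fin (r u)) : Slot r :=
  ⟨u.1, j, j.isLt.trans_le (by rcases u with ⟨i, _ | _⟩ <;> simp)⟩

theorem slot_injective (r : User M → ℕ) (u : User M) : Function.Injective (slot r u) := by
  intro j j' h
  simpa [slot, Fin.ext_iff] using h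

theorem exists_slot_eq {r : User M → ℕ} (a : Slot r) : ∃ b j, slot r (a.1, b) j = a := by
  obtain ⟨i, j, hj⟩ := a
  rcases lt_max_iff.mp hj with h | h
  · exact ⟨true, ⟨j, h⟩, rfl⟩
  · exact ⟨false, ⟨j, h⟩, rfl⟩

/-- Hall's condition for the allocation of levels below the thresholds `θ`. -/
theorem card_filter_slot_le (r θ : User M → ℕ) (Q t : ℕ)
    (h : ∀ (U : Finset (Fin M)) (ℓ : Fin M → Bool),
      ∑ i ∈ U, r (i, ℓ i) ≤ Q * U.sup fun i => θ (i, ℓ i))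
    (s : Finset (Slot r)) (hs : ∀ a ∈ s, ∃ b j, slot r (a.1, b) j = a ∧ θ (a.1, b) ≤ t) :
    s.card ≤ Q * t := by
  classical
  -- In each pair take, among the users with threshold at most `t`, one with the most bits. Its bits
  -- cover all slots of the pair that occur in `s`. The other pairs get an arbitrary value.
  have hℓ : ∀ i, ∃ b, (∃ b', θ (i, b') ≤ t) →
      θ (i, b) ≤ t ∧ ∀ b', θ (i, b') ≤ t → r (i, b') ≤ r (i, b) := by
    intro i
    by_cases ht : ∃ b', θ (i, b') ≤ t
    · obtain ⟨b, hb, hmax⟩ := Finset.exists_max_image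
        (Finset.univ.filter fun b => θ (i, b) ≤ t) (fun b => r (i, b))
        (by obtain ⟨b, hb⟩ := ht; exact ⟨b, by simpa using hb⟩)
      exact ⟨b, fun _ => ⟨by simpa using hb, fun b' hb' => hmax b' (by simpa using hb')⟩⟩
    · exact ⟨true, fun h => absurd h ht⟩
  choose ℓ hℓ using hℓ
  set U : Finset (Fin M) := Finset.univ.filter fun i => ∃ b, θ (i, b) ≤ t
  have hsub : s ⊆ U.sigma fun i => Finset.univ.filter
      fun j : Fin (max (r (i, true)) (r (i, false))) => (j : ℕ) < r (i, ℓ i) := by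
    intro a ha
    obtain ⟨b, j, hj, hb⟩ := hs a ha
    simp only [Finset.mem_sigma, Finset.mem_filter, Finset.mem_univ, true_and, U]
    rw [show (a.2 : ℕ) = j from congrArg (fun a : Slot r => (a.2 : ℕ)) hj.symm]
    exact ⟨⟨b, hb⟩, j.isLt.trans_le ((hℓ _ ⟨b, hb⟩).2 b hb)⟩
  calc s.card ≤ _ := Finset.card_le_card hsub
    _ = ∑ i ∈ U, (Finset.univ.filter
        fun j : Fin (max (r (i, true)) (r (i, false))) => (j : ℕ) < r (i, ℓ i)).card :=
      Finset.card_sigma _ _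
    _ ≤ ∑ i ∈ U, r (i, ℓ i) := by
      refine Finset.sum_le_sum fun i _ => ?_
      have := Finset.card_le_card_of_injOn
        (s := Finset.univ.filter
          fun j : Fin (max (r (i, true)) (r (i, false))) => (j : ℕ) < r (i, ℓ i))
        (t := Finset.range (r (i, ℓ i))) (fun j => (j : ℕ))
        (fun j hj => by simpa using hj) (fun j _ j' _ hjj => Fin.ext hjj)
      simpa using this
    _ ≤ Q * U.sup fun i => θ (i, ℓ i) := h U ℓ
    _ ≤ Q * t := Nat.mul_le_mul_left _ <| Finset.sup_le fun i hi =>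
      (hℓ i (by simpa [U] using hi)).1

/-- The slots can be put on the levels of a block such that the bits of `u` are on levels below
`θ u`. -/
theorem exists_allocation (r θ : User M → ℕ) (Q q : ℕ) (hθ : ∀ u, θ u ≤ q)
    (h : ∀ (U : Finset (Fin M)) (ℓ : Fin M → Bool),
      ∑ i ∈ U, r (i, ℓ i) ≤ Q * U.sup fun i => θ (i, ℓ i)) :
    ∃ f : Slot r → Fin Q × Fin q, Function.Injective f ∧
      ∀ u j, ((f (slot r u j)).2 : ℕ) < θ u := by
  classical
  -- the binding threshold of a slot
  have hT : ∀ a : Slot r, ∃ T, (∃ b j, slot r (a.1, b) j = a ∧ θ (a.1, b) = T) ∧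
      ∀ b j, slot r (a.1, b) j = a → T ≤ θ (a.1, b) := by
    intro a
    obtain ⟨b, hb, hmin⟩ := Finset.exists_min_image
      (Finset.univ.filter fun b => ∃ j, slot r (a.1, b) j = a) (fun b => θ (a.1, b))
      (by obtain ⟨b, hb⟩ := exists_slot_eq a; exact ⟨b, by simpa using hb⟩)
    obtain ⟨j, hj⟩ : ∃ j, slot r (a.1, b) j = a := by simpa using hb
    exact ⟨_, ⟨b, j, hj, rfl⟩, fun b' j' hj' => hmin b' (by simpa using ⟨j', hj'⟩)⟩
  choose T hT hTle using hT
  let A : Slot r → Finset (Fin Q × Fin q) := fun a =>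
    Finset.univ ×ˢ Finset.univ.filter fun l : Fin q => (l : ℕ) < T a
  have hTq : ∀ a, T a ≤ q := fun a => by
    obtain ⟨b, _, _, hb⟩ := hT a
    exact hb ▸ hθ _
  have hA : ∀ a, (A a).card = Q * T a := by
    intro a
    have : (Finset.univ.filter fun l : Fin q => (l : ℕ) < T a).card = T a := by
      rw [Fin.card_filter_val_lt, min_eq_right (hTq a)]
    simp [A, this]
  -- Hall's theorem; the sets `A a` are nested, so only the one with the largest threshold in `s`
  -- matters.
  obtain ⟨f, hf, hfA⟩ := (Finset.all_card_le_biUnion_card_iff_exists_injective A).mp (by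
    intro s
    rcases s.eq_empty_or_nonempty with rfl | hs
    · simp
    obtain ⟨a, ha, hmax⟩ := s.exists_max_image T hs
    calc s.card ≤ Q * T a := card_filter_slot_le r θ Q (T a) h s fun a' ha' => by
          obtain ⟨b, j, hj, hb⟩ := hT a'
          exact ⟨b, j, hj, hb ▸ hmax a' ha'⟩
      _ = (A a).card := (hA a).symm
      _ ≤ _ := Finset.card_le_card (Finset.subset_biUnion_of_mem A ha))
  refine ⟨f, hf, fun u j => ?_⟩
  have h₁ : ((f (slot r u j)).2 : ℕ) < T (slot r u j) := by
    simpa [A] using hfA (slot r u j)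
  exact h₁.trans_le (hTle (slot r u j) u.2 j rfl)

theorem exists_perm_apply_eq {α β : Type*} [Finite β] {f g : α → β}
    (hf : Function.Injective f) (hg : Function.Injective g) :
    ∃ σ : Equiv.Perm β, ∀ a, σ (f a) = g a := by
  classical
  have := Fintype.ofFinite β
  let e : {x // x ∈ Set.range f} ≃ {x // x ∈ Set.range g} :=
    (Equiv.ofInjective f hf).symm.trans (Equiv.ofInjective g hg)
  refine ⟨e.extendSubtype, fun a => ?_⟩
  rw [e.extendSubtype_apply_of_mem (f a) ⟨a, rfl⟩]
  simp only [e, Equiv.trans_apply]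
  rw [show (⟨f a, ⟨a, rfl⟩⟩ : {x // x ∈ Set.range f}) = Equiv.ofInjective f hf a from rfl,
    Equiv.symm_apply_apply]
  rfl

end Allocation

/-! ### The divide-and-conquer strategy of an allocation -/

section Scheme

variable {M : ℕ} (N : Network M) {Q : ℕ} (r : User M → ℕ) (f : Slot r → Fin Q × Fin N.q)

open Classical in
/-- The bit that `u` transmits on the level `p`, if the slots are allocated to the levels received by
the relay by `f`, which counts these levels from below. -/
noncomputable def placement (u : User M) (p : Fin Q × Fin N.q) : Option (Fin (r u)) :=
  -- The uplink moves level `m` to `m + (q - up u)`, which is number `up u - 1 - m` from below.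
  if h : ∃ j, (f (slot r u j)).1 = p.1 ∧ ((f (slot r u j)).2 : ℕ) + p.2 + 1 = N.up u
  then some h.choose else none

variable {N r f}

/-- What the relay receives from `u` on the level `l`. -/
theorem shift_placement_apply (hf : Function.Injective f)
    (hfu : ∀ u j, ((f (slot r u j)).2 : ℕ) < N.up u)
    (u : User M) (w : Vec (r u)) (k : Fin Q) (l : Fin N.q) :
    ((shiftMatrix N.q ^ (N.q - N.up u)) *ᵥ fun m => (placement N r f u (k, m)).elim 0 w) l =
      ∑ j, if f (slot r u j) = (k, l.rev) then w j else 0 := by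
  have hq := N.up_le_q u
  have hl := l.isLt
  rw [shiftMatrix_pow_mulVec_apply]
  by_cases h : ∃ j, f (slot r u j) = (k, l.rev)
  · obtain ⟨j, hj⟩ := h
    have hju := hfu u j
    have huniq : ∀ j', f (slot r u j') = (k, l.rev) → j' = j := fun j' hj' =>
      slot_injective r u (hf (hj'.trans hj.symm))
    rw [Finset.sum_eq_single j (fun j' _ hne => if_neg fun hj' => hne (huniq j' hj')) (by simp),
      if_pos hj]
    rw [hj, Fin.val_rev] at hju
    rw [dif_pos (by omega)]
    have hex : ∃ j', (f (slot r u j')).1 = k ∧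
        ((f (slot r u j')).2 : ℕ) + ((l : ℕ) - (N.q - N.up u)) + 1 = N.up u :=
      ⟨j, by rw [hj], by rw [hj]; simp only [Fin.val_rev]; omega⟩
    simp only [placement]
    rw [dif_pos hex]
    have hspec := hex.choose_spec
    have := huniq hex.choose (Prod.ext hspec.1 (Fin.ext (by
      have := hspec.2
      simp only [Fin.val_rev]
      omega)))
    simp [this]
  · push Not at h
    rw [Finset.sum_eq_zero fun j _ => if_neg (h j)]
    split_ifs with hd
    · simp only [placement]
      rw [dif_neg]
      · rfl
      · rintro ⟨j, hj₁, hj₂⟩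
        refine h j (Prod.ext hj₁ (Fin.ext ?_))
        simp only [Fin.val_rev]
        omega
    · rfl

/-- The slots are allocated twice: by `f` to levels received by the relay, counted from below, and
by `g` to levels sent by the relay, counted from above. A user reaches the lowest `up` levels and
hears the top `down` levels. -/
theorem exists_DCScheme (N : Network M) (Q : ℕ) (hQ : 0 < Q) (r : User M → ℕ)
    (hup : ∀ (U : Finset (Fin M)) (ℓ : Fin M → Bool),
      ∑ i ∈ U, r (i, ℓ i) ≤ Q * U.sup fun i => N.up (i, ℓ i))
    (hdown : ∀ (U : Finset (Fin M)) (ℓ : Fin M → Bool),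
      ∑ i ∈ U, r (i, ℓ i) ≤ Q * U.sup fun i => N.down (partner (i, ℓ i))) :
    ∃ s : DCScheme N Q, s.bits = r ∧ s.Correct := by
  classical
  obtain ⟨f, hf, hfu⟩ := exists_allocation r N.up Q N.q N.up_le_q hup
  obtain ⟨g, hg, hgd⟩ := exists_allocation r (fun u => N.down (partner u)) Q N.q
    (fun u => N.down_le_q _) hdown
  have hf' : Function.Injective fun a => ((f a).1, (f a).2.rev) := by
    intro a b hab
    simp only [Prod.mk.injEq, Fin.rev_inj] at hab
    exact hf (Prod.ext hab.1 hab.2)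
  -- On the level that `g` gives to a slot, the relay sends what it received on the level given by
  -- `f`.
  obtain ⟨σ, hσ⟩ := exists_perm_apply_eq hg hf'
  have hlev : ∀ u j, ((g (slot r (partner u) j)).2 : ℕ) + (N.q - N.down u) < N.q := by
    intro u j
    have h₁ := hgd (partner u) j
    have h₂ := N.down_le_q u
    rw [partner_partner] at h₁
    omega
  let s : DCScheme N Q :=
    { pos := hQ
      bits := r
      place := placement N r f
      owner := fun p => if h : ∃ a, f a = (p.1, p.2.rev) then some h.choose.1 else none
      orthogonal := by
        intro u w k l hne
        rw [shift_placement_apply hf hfu] at hne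
        obtain ⟨j, _, hj⟩ := Finset.exists_ne_zero_of_sum_ne_zero hne
        have hj : f (slot r u j) = (k, l.rev) := by
          by_contra hj'
          exact hj (if_neg hj')
        have hex : ∃ a, f a = (k, l.rev) := ⟨_, hj⟩
        simp only
        rw [dif_pos hex, hf (hex.choose_spec.trans hj.symm)]
        rfl
      perm := σ
      -- The downlink lowers the slot's level by `q - down u`; the user's own bit in that slot, if
      -- any, is subtracted.
      dec := fun u w y j =>
        y (g (slot r (partner u) j)).1 ⟨(g (slot r (partner u) j)).2 + (N.q - N.down u), hlev u j⟩ -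
          ∑ j', if f (slot r u j') = f (slot r (partner u) j) then w j' else 0 }
  refine ⟨s, rfl, fun w u => funext fun (j : Fin (r (partner u))) => ?_⟩
  have hrelay : ∀ a, s.relayReceived w (f a).1 (f a).2.rev =
      ∑ v : User M, ∑ j', if f (slot r v j') = f a then w v j' else 0 := by
    intro a
    rw [DCScheme.relayReceived, Network.receive_none, Finset.sum_apply]
    refine Finset.sum_congr rfl fun v _ => ?_
    have := shift_placement_apply hf hfu v (w v) (f a).1 (f a).2.rev
    rw [Fin.rev_rev] at this
    exact this
  have hrecv : s.userReceived (s.relayBlock (s.relayReceived w)) u (g (slot r (partner u) j)).1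
      ⟨(g (slot r (partner u) j)).2 + (N.q - N.down u), hlev u j⟩ =
      ∑ v : User M, ∑ j', if f (slot r v j') = f (slot r (partner u) j) then w v j' else 0 := by
    rw [DCScheme.userReceived, Network.receive_some, shiftMatrix_pow_mulVec_apply,
      dif_pos (by simp), ← hrelay]
    simp only [Nat.add_sub_cancel, Option.elim, DCScheme.relayBlock]
    rw [show s.perm = σ from rfl, hσ]
  -- As `f` is injective, only the two users of one pair can share a slot.
  have hpair : (∑ v : User M, ∑ j', if f (slot r v j') = f (slot r (partner u) j)
        then w v j' else 0) =
      (∑ j', if f (slot r u j') = f (slot r (partner u) j) then w u j' else 0) +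
      ∑ j', if f (slot r (partner u) j') = f (slot r (partner u) j)
        then w (partner u) j' else 0 := by
    have hne : u ≠ partner u := by
      rcases u with ⟨i, _ | _⟩ <;> simp [partner]
    rw [← Finset.sum_pair (f := fun v => ∑ j', if f (slot r v j') = f (slot r (partner u) j)
      then w v j' else 0) hne]
    refine (Finset.sum_subset (Finset.subset_univ _) fun v _ hv => ?_).symm
    refine Finset.sum_eq_zero fun j' _ => if_neg fun h => hv ?_
    have h₁ : v.1 = u.1 := congrArg Sigma.fst (hf h)
    obtain ⟨i, b⟩ := u
    obtain ⟨i', b'⟩ := v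
    simp only at h₁
    subst h₁
    cases b <;> cases b' <;> simp [partner]
  have hself : (∑ j', if f (slot r (partner u) j') = f (slot r (partner u) j)
      then w (partner u) j' else 0) = w (partner u) j := by
    rw [Finset.sum_eq_single j _ (fun h => absurd (Finset.mem_univ _) h)]
    · exact if_pos rfl
    · exact fun j' _ hne => if_neg fun h => hne (slot_injective r _ (hf h))
  change s.userReceived (s.relayBlock (s.relayReceived w)) u (g (slot r (partner u) j)).1
      ⟨(g (slot r (partner u) j)).2 + (N.q - N.down u), hlev u j⟩ -
      (∑ j', if f (slot r u j') = f (slot r (partner u) j) then w u j' else 0) = _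
  rw [hrecv, hpair, hself, add_sub_cancel_left]

end Scheme

/-! ### Repeating a strategy -/

namespace DCScheme

variable {M Q : ℕ} {N : Network M}

theorem toCode_recv_none (s : DCScheme N Q) (n : ℕ) (w : ∀ u, (s.toCode n).Msg u)
    (b : Fin (n / Q - 1)) (k : Fin Q) :
    (s.toCode n).recv w (b * Q + k) none = s.relayReceived (fun u => w u b) k := by
  have hdiv : ((b : ℕ) * Q + k) / Q = b := by
    rw [mul_comm, Nat.mul_add_div s.pos, Nat.div_eq_of_lt k.isLt, add_zero]
  have hmod : ((b : ℕ) * Q + k) % Q = k := by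
    rw [mul_comm, Nat.mul_add_mod, Nat.mod_eq_of_lt k.isLt]
  rw [Code.recv_none, relayReceived, Network.receive_none]
  refine Finset.sum_congr rfl fun u _ => ?_
  simp only [toCode, hdiv, hmod, b.isLt, dif_pos, Option.elim]

theorem toCode_recv_some (s : DCScheme N Q) (n : ℕ) (w : ∀ u, (s.toCode n).Msg u)
    (b : Fin (n / Q - 1)) (k : Fin Q) (u : User M) :
    (s.toCode n).recv w ((b + 1) * Q + k) (some u) =
      s.userReceived (s.relayBlock (s.relayReceived fun u => w u b)) u k := by
  have hdiv : (((b : ℕ) + 1) * Q + k) / Q = b + 1 := by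
    rw [mul_comm, Nat.mul_add_div s.pos, Nat.div_eq_of_lt k.isLt, add_zero]
  have hmod : (((b : ℕ) + 1) * Q + k) % Q = k := by
    rw [mul_comm, Nat.mul_add_mod, Nat.mod_eq_of_lt k.isLt]
  have hle : Q ≤ ((b : ℕ) + 1) * Q + k := by nlinarith
  -- During block `b + 1` all of block `b` is in the past, so `lookup` never returns its default.
  have hpast : ∀ k' : Fin Q, (b : ℕ) * Q + k' < (b + 1) * Q + k := fun k' => by
    have := k'.isLt
    nlinarith
  rw [Code.recv_some, userReceived, Network.receive_some]
  congr 1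
  simp only [toCode, hdiv, hmod, if_pos hle, Option.elim, Nat.add_sub_cancel]
  congr 1
  refine funext fun k' => ?_
  rw [lookup, dif_pos (hpast k')]
  exact s.toCode_recv_none n w b k'

theorem Correct.errorProb_toCode {s : DCScheme N Q} (hs : s.Correct) (n : ℕ) :
    (s.toCode n).errorProb = 0 := by
  have : IsEmpty {w : ∀ u, (s.toCode n).Msg u // ∃ u, (s.toCode n).dec u (w u)
      (fun t : Fin n => (s.toCode n).recv w t (some u)) ≠ w (partner u)} := by
    refine ⟨fun ⟨w, u, hu⟩ => hu (funext fun b => ?_)⟩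
    rw [← hs (fun u => w u b) u]
    change s.dec u (w u b) (fun k => lookup _ ((b + 1) * Q + k)) = _
    congr 1
    funext k
    -- Since `b < n / Q - 1`, block `b + 1` still lies within the `n` time steps.
    have hlt : ((b : ℕ) + 1) * Q + k < n := by
      have hb : (b : ℕ) + 2 ≤ n / Q := by omega
      have h₁ := Nat.mul_le_mul_right Q hb
      have h₂ := Nat.div_mul_le_self n Q
      have := k.isLt
      nlinarith
    rw [lookup, dif_pos hlt]
    exact s.toCode_recv_some n w b k u
  rw [Code.errorProb, Nat.card_of_isEmpty]
  simp

/-- One block is lost to the relay's delay and less than one to rounding. The factor `1 - δ` pays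
for these `2 * Q` time steps once `n * δ ≥ 2 * Q`. -/
theorem Correct.achievable {s : DCScheme N Q} (hs : s.Correct) {δ : ℝ} (hδ : 0 < δ) (hδ₁ : δ ≤ 1) :
    Achievable N (divideAndConquerCodes N) fun u => (1 - δ) * (s.bits u / Q) := by
  have hQ : (0 : ℝ) < Q := by exact_mod_cast s.pos
  refine ⟨fun u => mul_nonneg (by linarith) (by positivity), fun ε hε => ?_⟩
  obtain ⟨n₀, hn₀⟩ := exists_nat_ge (2 * Q / δ)
  refine ⟨n₀, fun n hn => ⟨s.toCode n, ⟨Q, s, rfl⟩, fun u => ?_, ?_⟩⟩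
  · have hcard : Nat.card ((s.toCode n).Msg u) = 2 ^ (s.bits u * (n / Q - 1)) := by
      change Nat.card (Fin (n / Q - 1) → Vec (s.bits u)) = _
      simp [← pow_mul]
    rw [hcard, Nat.cast_pow, Nat.cast_ofNat, ← Real.rpow_natCast]
    refine Real.rpow_le_rpow_of_exponent_le (by norm_num) ?_
    have hdiv : (n : ℝ) < Q * ((n / Q : ℕ) + 1) := by
      exact_mod_cast Nat.lt_mul_div_succ n s.pos
    have hsub : ((n / Q : ℕ) : ℝ) - 1 ≤ (n / Q - 1 : ℕ) := by
      rw [sub_le_iff_le_add]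
      exact_mod_cast Nat.sub_le_iff_le_add.mp le_rfl
    have hnδ : 2 * Q ≤ n * δ := by
      rw [div_le_iff₀ hδ] at hn₀
      exact hn₀.trans (mul_le_mul_of_nonneg_right (by exact_mod_cast hn) hδ.le)
    have hkey : (n : ℝ) * (1 - δ) / Q ≤ (n / Q - 1 : ℕ) := by
      rw [div_le_iff₀ hQ]
      nlinarith
    push_cast
    calc (n : ℝ) * ((1 - δ) * (s.bits u / Q)) = s.bits u * (n * (1 - δ) / Q) := by ring
      _ ≤ _ := mul_le_mul_of_nonneg_left hkey (by positivity)
  · rw [hs.errorProb_toCode]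
    exact hε.le

end DCScheme

/-! ### Achievability of the whole cut-set region -/

section Region

variable {M : ℕ} {N : Network M}

theorem exists_correct_DCScheme {Q : ℕ} (hQ : 0 < Q) {R : User M → ℝ} (hR : R ∈ N.cutSetRegion)
    {r : User M → ℕ} (hr : ∀ u, (r u : ℝ) ≤ Q * R u) :
    ∃ s : DCScheme N Q, s.bits = r ∧ s.Correct := by
  have key : ∀ (U : Finset (Fin M)) (ℓ : Fin M → Bool), ∑ i ∈ U, r (i, ℓ i) ≤
      Q * min (U.sup fun i => N.up (i, ℓ i)) (U.sup fun i => N.down (partner (i, ℓ i))) := by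
    intro U ℓ
    have h : ∑ i ∈ U, (r (i, ℓ i) : ℝ) ≤ Q * ∑ i ∈ U, R (i, ℓ i) := by
      rw [Finset.mul_sum]
      exact Finset.sum_le_sum fun i _ => hr _
    have h' := h.trans (mul_le_mul_of_nonneg_left (hR.2 U ℓ) (Nat.cast_nonneg Q))
    exact_mod_cast h'
  exact exists_DCScheme N Q hQ r
    (fun U ℓ => (key U ℓ).trans (Nat.mul_le_mul_left _ (min_le_left _ _)))
    (fun U ℓ => (key U ℓ).trans (Nat.mul_le_mul_left _ (min_le_right _ _)))

/-- Blocks of length `k + 1` carry the rounded-down `(k + 1) * R u` bits; with `δ = 1 / (k + 1)` the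
resulting rates tend to `R`. -/
theorem cutSetRegion_subset_achievableRegion (N : Network M) :
    N.cutSetRegion ⊆ achievableRegion N (divideAndConquerCodes N) := by
  intro R hR
  have hach : ∀ k : ℕ, Achievable N (divideAndConquerCodes N) fun u =>
      (1 - 1 / ((k : ℝ) + 1)) * ((⌊((k : ℝ) + 1) * R u⌋₊ : ℝ) / ((k : ℝ) + 1)) := by
    intro k
    obtain ⟨s, hs, hcor⟩ := exists_correct_DCScheme (Nat.succ_pos k) hR
      (r := fun u => ⌊((k : ℝ) + 1) * R u⌋₊) fun u => by
        push_cast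
        exact Nat.floor_le (mul_nonneg (by positivity) (hR.1 u))
    have := hcor.achievable (δ := 1 / ((k : ℝ) + 1)) (by positivity) (by
      rw [div_le_one (by positivity)]
      linarith [(Nat.cast_nonneg k : (0 : ℝ) ≤ k)])
    rw [hs] at this
    simpa using this
  refine mem_closure_of_tendsto (b := Filter.atTop) ?_ (Filter.Eventually.of_forall hach)
  refine tendsto_pi_nhds.mpr fun u => ?_
  have h₁ : Filter.Tendsto (fun k : ℕ => 1 - 1 / ((k : ℝ) + 1)) Filter.atTop (nhds 1) := by
    simpa using tendsto_one_div_add_atTop_nhds_zero_nat.const_sub (1 : ℝ)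
  have h₂ : Filter.Tendsto (fun k : ℕ => (⌊((k : ℝ) + 1) * R u⌋₊ : ℝ) / ((k : ℝ) + 1))
      Filter.atTop (nhds (R u)) := by
    have h := (tendsto_nat_floor_mul_div_atTop (hR.1 u)).comp
      (tendsto_natCast_atTop_atTop.atTop_add (tendsto_const_nhds (x := (1 : ℝ))))
    simpa [Function.comp_def, mul_comm] using h
  simpa using h₁.mul h₂

end Region

end BidirectionalRelay

theorem theorem1 {M : ℕ} (N : BidirectionalRelay.Network M) :
    BidirectionalRelay.capacityRegion N = N.cutSetRegion ∧
    BidirectionalRelay.achievableRegion N (BidirectionalRelay.divideAndConquerCodes N) =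
      N.cutSetRegion ∧
    ∀ (Q : ℕ), 0 < Q → ∀ R ∈ N.cutSetRegion, ∀ r : BidirectionalRelay.User M → ℕ,
      (∀ u, (Q : ℝ) * R u = r u) →
      ∃ s : BidirectionalRelay.DCScheme N Q, s.bits = r ∧ s.Correct := by
  have hcut := BidirectionalRelay.cutSetRegion_subset_achievableRegion N
  exact ⟨(BidirectionalRelay.achievableRegion_subset_cutSetRegion _).antisymm
      (hcut.trans (BidirectionalRelay.achievableRegion_subset_capacityRegion _)),
    (BidirectionalRelay.achievableRegion_subset_cutSetRegion _).antisymm hcut,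
    fun Q hQ R hR r hr =>
      BidirectionalRelay.exists_correct_DCScheme hQ hR fun u => (hr u).ge⟩
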